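/- **Theorem (constraint violation of Sinkhorn for POT).** Let $n\ge 2$, let $C\in\mathbb R_+^{n\times n}$ be a cost matrix, let $r,c\in\mathbb R_+^n$, let $0\le s<\min\{\|r\|_1,\|c\|_1\}$, let $A>\max_{i,j}C_{ij}$ and $\varepsilon>0$. Put $$\widetilde C=\begin{pmatrix}C&0\\0&A\end{pmatrix},\qquad \widetilde r=(r,\|c\|_1-s),\qquad \widetilde c=(c,\|r\|_1-s).$$ Run Sinkhorn on $(\widetilde C,\widetilde r,\widetilde c)$ with regularization $\gamma=\varepsilon/(4\log n)$: with $K=\exp(-\widetilde C/\gamma)$ (entrywise), start from $a=b=\mathbf 1$ and alternately reset $a$ so that $\mathrm{diag}(a)K\,\mathrm{diag}(b)$ has row sums $\widetilde r$, and $b$ so that it has column sums $\widetilde c$. Take an iterate $X=\mathrm{diag}(a)K\,\mathrm{diag}(b)$ that passes the stopping test $$\|X\mathbf 1-\widetilde r\|_1+\|X^\top\mathbf 1-\widetilde c\|_1\le \frac{\varepsilon}{8\|\widetilde C\|_{\max}}.$$ Round $X$ to a coupling of $\widetilde r$ and $\widetilde c$ by the procedure of Altschuler, Weed and Rigollet: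 $F'=\mathrm{diag}(\min\{\widetilde r/(X\mathbf 1),1\})\,X$, $F''=F'\,\mathrm{diag}(\min\{\widetilde c/(F'^\top\mathbf 1),1\})$, $e=\widetilde r-F''\mathbf 1$, $e'=\widetilde c-F''^\top\mathbf 1$, and the output is $F''+e\,e'^\top/\|e\|_1$ (or $F''$ if $e=0$). Let $\bar X\in\mathbb R^{n\times n}$ be the result without its dummy row and column, and let $V=\mathbf 1^\top\bar X\mathbf 1-s$ be the constraint violation. There are absolute constants $K_1,K_2>0$ such that always 1. $V>0$; 2. $\displaystyle V\le K_1\,(1+\|r\|_1+\|c\|_1)\,\frac{\max\{\|C\|_{\max},\varepsilon\}}{A}$; 3. for every $\kappa\ge 0$ with $\|r\|_1,\|c\|_1\le n^{\kappa}$ and $\|r\|_1-s,\ \|c\|_1-s\ge n^{-\kappa}$, $$V\ \ge\ \exp\!\left(-\frac{12A\log n}{\varepsilon}-K_2(1+\kappa)\log n\right).$$ In particular, for masses of order $O(1)$, dummy masses $\|r\|_1-s$, $\|c\|_1-s$ that are at least inverse polynomial in $n$, and accuracy $\varepsilon\le\|C\|_{\max}$, one has $O(\|C\|_{\max}/A)\ge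 V\ge\exp(-12A\log n/\varepsilon-O(\log n))>0$. -/

import Mathlib

open scoped Matrix

namespace POT

noncomputable section

/-- The entrywise maximum norm `‖C‖_max = max_{i,j} |C i j|` (the index type is finite, and the
value is `0` when it is empty). -/
def maxNorm {ι : Type*} [Fintype ι] (C : Matrix ι ι ℝ) : ℝ :=
  ⨆ p : ι × ι, |C p.1 p.2|

/-- The extended cost matrix: one dummy point is added on each side, at cost `0` to the genuine
points and at cost `A` to the other dummy point. The extra index `n + 1` is `Sum.inr ()`. -/
def extCost {n : ℕ} (C : Matrix (Fin n) (Fin n) ℝ) (A : ℝ) :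
    Matrix (Fin n ⊕ Unit) (Fin n ⊕ Unit) ℝ :=
  Matrix.fromBlocks C 0 0 (Matrix.of fun _ _ => A)

/-- The extended marginal `(r, ‖c‖₁ - s)` of a nonnegative vector `r`, where `c` is the other
(nonnegative) marginal; the second extended marginal `(c, ‖r‖₁ - s)` is `extMarginal c r s`. -/
def extMarginal {n : ℕ} (r c : Fin n → ℝ) (s : ℝ) : Fin n ⊕ Unit → ℝ :=
  Sum.elim r fun _ => (∑ j, c j) - s

section Sinkhorn

variable {ι : Type*} [Fintype ι]

/-- The Gibbs kernel `exp (-C / γ)` (entrywise). -/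
def gibbs (C : Matrix ι ι ℝ) (γ : ℝ) : Matrix ι ι ℝ :=
  Matrix.of fun i j => Real.exp (-C i j / γ)

/-- The scaling vectors `(a, b) = (exp u, exp v)` of the Sinkhorn iteration with kernel `K` and
marginals `r`, `c`, from `u = v = 0`: at even steps `a` is reset so that the row sums of
`diag a * K * diag b` are `r`, at odd steps `b` is reset so that its column sums are `c`. -/
def sinkhornScaling (K : Matrix ι ι ℝ) (r c : ι → ℝ) : ℕ → (ι → ℝ) × (ι → ℝ)
  | 0 => (1, 1)
  | k + 1 =>
    let p := sinkhornScaling K r c k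
    if Even k then (fun i => r i / (K *ᵥ p.2) i, p.2)
    else (p.1, fun j => c j / (Kᵀ *ᵥ p.1) j)

/-- The `k`-th Sinkhorn matrix `diag a * exp (-C / γ) * diag b`. -/
def sinkhornPlan (C : Matrix ι ι ℝ) (r c : ι → ℝ) (γ : ℝ) (k : ℕ) : Matrix ι ι ℝ :=
  Matrix.of fun i j =>
    (sinkhornScaling (gibbs C γ) r c k).1 i * gibbs C γ i j *
      (sinkhornScaling (gibbs C γ) r c k).2 j

/-- The marginal error `‖X 1 - r‖₁ + ‖Xᵀ 1 - c‖₁`. -/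
def marginalError (X : Matrix ι ι ℝ) (r c : ι → ℝ) : ℝ :=
  (∑ i, |(∑ j, X i j) - r i|) + ∑ j, |(∑ i, X i j) - c j|

/-- `X` is an output of Sinkhorn with regularization `γ` and tolerance `δ`: an iterate that passes
the stopping test. The first such iterate is the usual output; a later one is also accepted, so
that it does not matter how often the test is made. -/
def IsSinkhornOutput (C : Matrix ι ι ℝ) (r c : ι → ℝ) (γ δ : ℝ) (X : Matrix ι ι ℝ) : Prop :=
  ∃ k : ℕ, X = sinkhornPlan C r c γ k ∧ marginalError X r c ≤ δ

/-- First step of the rounding: `F' = diag (min (r / F 1) 1) * F`. (Where a row sum of the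
nonnegative matrix `F` is zero, the row is zero and the factor is immaterial.) -/
def roundRows (F : Matrix ι ι ℝ) (r : ι → ℝ) : Matrix ι ι ℝ :=
  Matrix.of fun i j => min (r i / ∑ l, F i l) 1 * F i j

/-- Second step of the rounding: `F'' = F' * diag (min (c / F'ᵀ 1) 1)`. -/
def roundCols (F : Matrix ι ι ℝ) (c : ι → ℝ) : Matrix ι ι ℝ :=
  Matrix.of fun i j => F i j * min (c j / ∑ l, F l j) 1

/-- The rounding of Altschuler, Weed and Rigollet of `F` onto the couplings of `r` and `c`:
`F'' + e e'ᵀ / ‖e‖₁` with `e = r - F'' 1`, `e' = c - F''ᵀ 1` (and `F''` itself if `e = 0`). -/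
def roundOT (F : Matrix ι ι ℝ) (r c : ι → ℝ) : Matrix ι ι ℝ :=
  let F'' := roundCols (roundRows F r) c
  let e : ι → ℝ := fun i => r i - ∑ j, F'' i j
  let e' : ι → ℝ := fun j => c j - ∑ i, F'' i j
  Matrix.of fun i j => F'' i j + e i * e' j / ∑ l, |e l|

end Sinkhorn

/-- `Xbar` is the matrix returned by Sinkhorn for POT with accuracy `ε`: Sinkhorn is run on the
extended problem with `γ = ε / (4 log n)` until the marginal error is at most `ε / (8 ‖C̃‖_max)`,
its output is rounded onto the couplings of the extended marginals, and the dummy row and column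
are deleted. -/
def IsSinkhornPOT {n : ℕ} (C : Matrix (Fin n) (Fin n) ℝ) (r c : Fin n → ℝ) (s A ε : ℝ)
    (Xbar : Matrix (Fin n) (Fin n) ℝ) : Prop :=
  ∃ X : Matrix (Fin n ⊕ Unit) (Fin n ⊕ Unit) ℝ,
    IsSinkhornOutput (extCost C A) (extMarginal r c s) (extMarginal c r s)
      (ε / (4 * Real.log n)) (ε / (8 * maxNorm (extCost C A))) X ∧
    Xbar = (roundOT X (extMarginal r c s) (extMarginal c r s)).toBlocks₁₁

/-- The violation `1ᵀ X 1 - s` of the total mass constraint. -/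
def violation {n : ℕ} (X : Matrix (Fin n) (Fin n) ℝ) (s : ℝ) : ℝ :=
  (∑ i, ∑ j, X i j) - s

end

end POT

/-! Write `d` for the dummy index, `X` for the Sinkhorn iterate, `Y` for its rounding, `δ` for the
marginal tolerance and `T` for a bound on the mass of `X`. As `Y` is an exact coupling of the
extended marginals, subtracting its dummy column from its genuine rows gives V = Y_dd
(`violation_eq_roundOT`).

Upper bound: diagonal scaling preserves cross ratios, so X_dd X_ij ≤ e^{-A/γ} X_id X_dj for genuine
i, j. Summed, X_dd times the genuine mass is at most e^{-A/γ} T². The marginals force the genuine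
mass to be at least X_dd up to 2δ, hence X_dd = O(δ + T e^{-A/(2γ)}) (`sinkhornPlan_dummy_le`). Both
terms are O(ε/A) up to the masses, and rounding adds at most 2δ (`roundOT_le`).

Lower bound: all entries of the kernel lie in [η, 1] with η = e^{-A/γ}, so the entries of each
scaling vector are bounded by a fixed multiple of its entry at `d`, uniformly in the step
(`dominated_sinkhornScaling`). This bounds X_dd below by a multiple of η² (`le_sinkhornPlan_succ`),
and rounding keeps a fixed fraction of it (`mul_le_roundOT`). -/

namespace POT

/-! ### Rounding onto couplings -/

section Rounding

variable {ι : Type*} [Fintype ι]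

lemma roundRows_nonneg {F : Matrix ι ι ℝ} {r : ι → ℝ} (hF : ∀ i j, 0 ≤ F i j) (hr : ∀ i, 0 ≤ r i)
    (i j : ι) : 0 ≤ roundRows F r i j :=
  mul_nonneg (le_min (div_nonneg (hr i) (Finset.sum_nonneg fun l _ => hF i l)) zero_le_one) (hF i j)

lemma roundRows_le {F : Matrix ι ι ℝ} {r : ι → ℝ} (hF : ∀ i j, 0 ≤ F i j) (i j : ι) :
    roundRows F r i j ≤ F i j :=
  mul_le_of_le_one_left (hF i j) (min_le_right _ _)

lemma sum_roundRows {F : Matrix ι ι ℝ} {r : ι → ℝ} (hF : ∀ i j, 0 ≤ F i j) (hr : ∀ i, 0 ≤ r i)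
    (i : ι) : ∑ j, roundRows F r i j = min (r i) (∑ j, F i j) := by
  simp only [roundRows, Matrix.of_apply, ← Finset.mul_sum]
  rcases (Finset.sum_nonneg fun l (_ : l ∈ Finset.univ) => hF i l).eq_or_lt with h | h
  · rw [← h, mul_zero, min_eq_right (hr i)]
  · rw [min_mul_of_nonneg _ _ h.le, div_mul_cancel₀ _ h.ne', one_mul]

lemma mul_le_roundRows {F : Matrix ι ι ℝ} {r : ι → ℝ} (hF : ∀ i j, 0 ≤ F i j) {ρ T : ℝ}
    (hρ : 0 ≤ ρ) (hρT : ρ ≤ T) {i : ι} (hri : ρ ≤ r i) (hT : ∑ l, F i l ≤ T) (j : ι) :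
    ρ / T * F i j ≤ roundRows F r i j := by
  have h0 := Finset.sum_nonneg fun l (_ : l ∈ Finset.univ) => hF i l
  rcases h0.eq_or_lt with h | h
  · have := (Finset.sum_eq_zero_iff_of_nonneg fun l _ => hF i l).1 h.symm j (Finset.mem_univ j)
    simp [roundRows, this]
  · exact mul_le_mul_of_nonneg_right (le_min (div_le_div₀ (hρ.trans hri) hri h hT)
      (div_le_one_of_le₀ hρT (h.le.trans hT))) (hF i j)

lemma roundCols_apply (F : Matrix ι ι ℝ) (c : ι → ℝ) (i j : ι) :
    roundCols F c i j = roundRows Fᵀ c j i := by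
  simp [roundCols, roundRows, mul_comm]

lemma roundCols_roundRows_le_roundRows {F : Matrix ι ι ℝ} {r : ι → ℝ} (c : ι → ℝ)
    (hF : ∀ i j, 0 ≤ F i j) (hr : ∀ i, 0 ≤ r i) (i j : ι) :
    roundCols (roundRows F r) c i j ≤ roundRows F r i j := by
  rw [roundCols_apply]
  exact roundRows_le (fun i j => roundRows_nonneg hF hr j i) _ _

lemma sum_row_roundCols_roundRows_le {F : Matrix ι ι ℝ} {r : ι → ℝ} (c : ι → ℝ)
    (hF : ∀ i j, 0 ≤ F i j) (hr : ∀ i, 0 ≤ r i) (i : ι) :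
    ∑ j, roundCols (roundRows F r) c i j ≤ r i :=
  (Finset.sum_le_sum fun j _ => roundCols_roundRows_le_roundRows c hF hr i j).trans
    ((sum_roundRows hF hr i).trans_le (min_le_left _ _))

lemma sum_col_roundCols_roundRows {F : Matrix ι ι ℝ} {r c : ι → ℝ} (hF : ∀ i j, 0 ≤ F i j)
    (hr : ∀ i, 0 ≤ r i) (hc : ∀ j, 0 ≤ c j) (j : ι) :
    ∑ i, roundCols (roundRows F r) c i j = min (c j) (∑ i, roundRows F r i j) := by
  simp only [roundCols_apply]
  exact sum_roundRows (fun i j => roundRows_nonneg hF hr j i) hc j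

/-- The mass removed by the two rescaling steps is controlled by the marginal error. -/
lemma sum_sub_sum_roundCols_roundRows_le {F : Matrix ι ι ℝ} {r c : ι → ℝ}
    (hF : ∀ i j, 0 ≤ F i j) (hr : ∀ i, 0 ≤ r i) (hc : ∀ j, 0 ≤ c j) :
    ∑ i, (r i - ∑ j, roundCols (roundRows F r) c i j) ≤ 2 * marginalError F r c := by
  have h1 : ∑ i, (r i - ∑ j, roundRows F r i j) ≤ ∑ i, |(∑ j, F i j) - r i| := by
    refine Finset.sum_le_sum fun i _ => ?_
    rw [sum_roundRows hF hr]
    rcases min_cases (r i) (∑ j, F i j) with h | h <;>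
      linarith [neg_abs_le ((∑ j, F i j) - r i), abs_nonneg ((∑ j, F i j) - r i)]
  -- Column sums only decrease in the row step, so the excess over `c` is at most that of `F`. The
  -- two bounds already add up to `marginalError`; the factor 2 is slack.
  have h2 : ∑ j, ((∑ i, roundRows F r i j) - ∑ i, roundCols (roundRows F r) c i j) ≤
      ∑ j, |(∑ i, F i j) - c j| := by
    refine Finset.sum_le_sum fun j _ => ?_
    rw [sum_col_roundCols_roundRows hF hr hc]
    have := Finset.sum_le_sum fun i (_ : i ∈ Finset.univ) => roundRows_le (r := r) hF i j
    rcases min_cases (c j) (∑ i, roundRows F r i j) with h | h <;>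
      linarith [le_abs_self ((∑ i, F i j) - c j), abs_nonneg ((∑ i, F i j) - c j)]
  have h3 : 0 ≤ ∑ i, |(∑ j, F i j) - r i| := Finset.sum_nonneg fun _ _ => abs_nonneg _
  have h4 : 0 ≤ ∑ j, |(∑ i, F i j) - c j| := Finset.sum_nonneg fun _ _ => abs_nonneg _
  have e1 := Finset.sum_comm (s := Finset.univ) (t := Finset.univ) (f := roundRows F r)
  have e2 := Finset.sum_comm (s := Finset.univ) (t := Finset.univ)
    (f := roundCols (roundRows F r) c)
  simp only [Finset.sum_sub_distrib, marginalError] at *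
  linarith

lemma roundOT_apply {F : Matrix ι ι ℝ} {r : ι → ℝ} (c : ι → ℝ) (hF : ∀ i j, 0 ≤ F i j)
    (hr : ∀ i, 0 ≤ r i) (i j : ι) :
    roundOT F r c i j = roundCols (roundRows F r) c i j +
      (r i - ∑ l, roundCols (roundRows F r) c i l) *
      (c j - ∑ l, roundCols (roundRows F r) c l j) /
        ∑ k, (r k - ∑ l, roundCols (roundRows F r) c k l) := by
  simp only [roundOT, Matrix.of_apply]
  congr 2
  exact Finset.sum_congr rfl fun k _ =>
    abs_of_nonneg (sub_nonneg.2 (sum_row_roundCols_roundRows_le c hF hr k))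

lemma sum_col_defect {F : Matrix ι ι ℝ} {r c : ι → ℝ} (h : ∑ i, r i = ∑ j, c j) :
    ∑ j, (c j - ∑ i, F i j) = ∑ i, (r i - ∑ j, F i j) := by
  rw [Finset.sum_sub_distrib, Finset.sum_sub_distrib, h, Finset.sum_comm]

lemma sum_rank_one_correction {e e' : ι → ℝ} (he : ∀ i, 0 ≤ e i) (h : ∑ j, e' j = ∑ i, e i)
    (i : ι) : ∑ j, e i * e' j / ∑ k, e k = e i := by
  rw [← Finset.sum_div, ← Finset.mul_sum, h]
  -- If the total defect vanishes, so does each `e i`, and division by zero gives the intended zero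
  -- correction.
  by_cases h0 : ∑ k, e k = 0
  · rw [(Finset.sum_eq_zero_iff_of_nonneg fun k _ => he k).1 h0 i (Finset.mem_univ i)]
    simp
  · exact mul_div_cancel_right₀ _ h0

lemma sum_row_roundOT {F : Matrix ι ι ℝ} {r c : ι → ℝ} (hF : ∀ i j, 0 ≤ F i j)
    (hr : ∀ i, 0 ≤ r i) (h : ∑ i, r i = ∑ j, c j) (i : ι) :
    ∑ j, roundOT F r c i j = r i := by
  simp only [roundOT_apply c hF hr, Finset.sum_add_distrib]
  rw [sum_rank_one_correction
    (e := fun i => r i - ∑ l, roundCols (roundRows F r) c i l)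
    (e' := fun j => c j - ∑ l, roundCols (roundRows F r) c l j)
    (fun k => sub_nonneg.2 (sum_row_roundCols_roundRows_le c hF hr k)) (sum_col_defect h)]
  ring

lemma col_defect_nonneg {F : Matrix ι ι ℝ} {r c : ι → ℝ} (hF : ∀ i j, 0 ≤ F i j)
    (hr : ∀ i, 0 ≤ r i) (hc : ∀ j, 0 ≤ c j) (j : ι) :
    0 ≤ c j - ∑ i, roundCols (roundRows F r) c i j := by
  rw [sum_col_roundCols_roundRows hF hr hc]
  exact sub_nonneg.2 (min_le_left _ _)

lemma sum_col_roundOT {F : Matrix ι ι ℝ} {r c : ι → ℝ} (hF : ∀ i j, 0 ≤ F i j)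
    (hr : ∀ i, 0 ≤ r i) (hc : ∀ j, 0 ≤ c j) (h : ∑ i, r i = ∑ j, c j) (j : ι) :
    ∑ i, roundOT F r c i j = c j := by
  simp only [roundOT_apply c hF hr, Finset.sum_add_distrib]
  rw [← sum_col_defect h]
  have := sum_rank_one_correction
    (e := fun j => c j - ∑ l, roundCols (roundRows F r) c l j)
    (e' := fun i => r i - ∑ l, roundCols (roundRows F r) c i l)
    (col_defect_nonneg hF hr hc) (sum_col_defect h).symm j
  simp only [mul_comm (c j - _)] at this
  rw [this]
  ring

lemma roundOT_le {F : Matrix ι ι ℝ} {r c : ι → ℝ} (hF : ∀ i j, 0 ≤ F i j)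
    (hr : ∀ i, 0 ≤ r i) (hc : ∀ j, 0 ≤ c j) (h : ∑ i, r i = ∑ j, c j) (i j : ι) :
    roundOT F r c i j ≤ F i j + 2 * marginalError F r c := by
  have he := fun k => sub_nonneg.2 (sum_row_roundCols_roundRows_le (F := F) c hF hr k)
  have he' := col_defect_nonneg hF hr hc
  rw [roundOT_apply c hF hr]
  refine add_le_add ((roundCols_roundRows_le_roundRows c hF hr i j).trans (roundRows_le hF i j)) ?_
  refine le_trans ?_ (sum_sub_sum_roundCols_roundRows_le hF hr hc)
  refine le_trans ?_ (Finset.single_le_sum (fun k _ => he k) (Finset.mem_univ i))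
  -- The defects `e` and `e'` have the same total, so `e' j / ‖e‖₁ ≤ 1`.
  rw [mul_div_assoc]
  refine mul_le_of_le_one_right (he i) (div_le_one_of_le₀ ?_ (Finset.sum_nonneg fun k _ => he k))
  rw [← sum_col_defect h]
  exact Finset.single_le_sum (fun k _ => he' k) (Finset.mem_univ j)

/-- Row and column sums never exceed the total mass, so each of the two rescaling factors is at
least `ρ / T`; the rank-one correction is nonnegative. -/
lemma mul_le_roundOT {F : Matrix ι ι ℝ} {r c : ι → ℝ} (hF : ∀ i j, 0 ≤ F i j)
    (hr : ∀ i, 0 ≤ r i) (hc : ∀ j, 0 ≤ c j) {ρ T : ℝ} (hρ : 0 ≤ ρ)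
    (hρT : ρ ≤ T) (hT : ∑ i, ∑ j, F i j ≤ T) {i j : ι} (hri : ρ ≤ r i) (hcj : ρ ≤ c j) :
    (ρ / T) ^ 2 * F i j ≤ roundOT F r c i j := by
  have he := fun k => sub_nonneg.2 (sum_row_roundCols_roundRows_le (F := F) c hF hr k)
  have he' := col_defect_nonneg hF hr hc
  have h1 : ρ / T * F i j ≤ roundRows F r i j :=
    mul_le_roundRows hF hρ hρT hri ((Finset.single_le_sum
      (f := fun k => ∑ l, F k l) (fun k _ => Finset.sum_nonneg fun l _ => hF k l)
      (Finset.mem_univ i)).trans hT) j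
  have h2 : ρ / T * roundRows F r i j ≤ roundCols (roundRows F r) c i j := by
    rw [roundCols_apply]
    refine mul_le_roundRows (F := (roundRows F r)ᵀ) (fun i j => roundRows_nonneg hF hr j i)
      hρ hρT hcj (le_trans ?_ hT) i
    refine Finset.sum_le_sum fun k _ => (roundRows_le hF k j).trans ?_
    exact Finset.single_le_sum (fun l _ => hF k l) (Finset.mem_univ j)
  rw [roundOT_apply c hF hr]
  have h3 := mul_le_mul_of_nonneg_left h1 (div_nonneg hρ (hρ.trans hρT))
  have h4 := div_nonneg (mul_nonneg (he i) (he' j)) (Finset.sum_nonneg (s := Finset.univ) fun k _ => he k)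
  calc (ρ / T) ^ 2 * F i j = ρ / T * (ρ / T * F i j) := by ring
    _ ≤ roundCols (roundRows F r) c i j := h3.trans h2
    _ ≤ _ := le_add_of_nonneg_right h4

end Rounding

/-! ### Sinkhorn scalings and the dominating index -/

section Scaling

variable {ι : Type*} [Fintype ι]

/-- One half step of Sinkhorn: the scaling that gives the rows of `diag a * K * diag b` the
sums `r`. -/
noncomputable def rescale (K : Matrix ι ι ℝ) (r b : ι → ℝ) : ι → ℝ :=
  fun i => r i / (K *ᵥ b) i

lemma sinkhornScaling_succ_of_even (K : Matrix ι ι ℝ) (r c : ι → ℝ) {k : ℕ} (hk : Even k) :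
    sinkhornScaling K r c (k + 1) =
      (rescale K r (sinkhornScaling K r c k).2, (sinkhornScaling K r c k).2) := by
  simp only [sinkhornScaling, hk, if_true]
  rfl

lemma sinkhornScaling_succ_of_not_even (K : Matrix ι ι ℝ) (r c : ι → ℝ) {k : ℕ} (hk : ¬ Even k) :
    sinkhornScaling K r c (k + 1) =
      ((sinkhornScaling K r c k).1, rescale Kᵀ c (sinkhornScaling K r c k).1) := by
  simp only [sinkhornScaling, hk, if_false]
  rfl

lemma mulVec_pos {K : Matrix ι ι ℝ} (hK : ∀ i j, 0 < K i j) {b : ι → ℝ} (hb : ∀ j, 0 ≤ b j)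
    {d : ι} (hd : 0 < b d) (i : ι) : 0 < (K *ᵥ b) i :=
  Finset.sum_pos' (fun j _ => mul_nonneg (hK i j).le (hb j))
    ⟨d, Finset.mem_univ d, mul_pos (hK i d) hd⟩

/-- `a` is nonnegative, positive at `d`, and bounded by `W * a d`. -/
structure Dominated (d : ι) (W : ℝ) (a : ι → ℝ) : Prop where
  nonneg : ∀ i, 0 ≤ a i
  pos : 0 < a d
  le : ∀ i, a i ≤ W * a d

/-- Any two entries of `K *ᵥ b` differ by a factor of at most `1 / η`. The new constant does not
involve `W'`, so nothing accumulates under iteration. -/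
lemma Dominated.rescale {K : Matrix ι ι ℝ} {η L W' : ℝ} {d : ι} {r b : ι → ℝ} (hη : 0 < η)
    (hK : ∀ i j, η ≤ K i j) (hK1 : ∀ i j, K i j ≤ 1) (hr : Dominated d L r)
    (hb : Dominated d W' b) : Dominated d (L / η) (rescale K r b) := by
  have hKp : ∀ i j, 0 < K i j := fun i j => hη.trans_le (hK i j)
  have hpos := mulVec_pos hKp hb.nonneg hb.pos
  refine ⟨fun i => div_nonneg (hr.nonneg i) (hpos i).le, div_pos hr.pos (hpos d), fun i => ?_⟩
  have hcmp : η * (K *ᵥ b) d ≤ (K *ᵥ b) i := by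
    simp only [Matrix.mulVec, dotProduct, Finset.mul_sum]
    refine Finset.sum_le_sum fun j _ => ?_
    rw [← mul_assoc]
    exact mul_le_mul_of_nonneg_right ((mul_le_of_le_one_right hη.le (hK1 d j)).trans (hK i j))
      (hb.nonneg j)
  calc r i / (K *ᵥ b) i ≤ L * r d / (η * (K *ᵥ b) d) :=
        div_le_div₀ ((hr.nonneg i).trans (hr.le i)) (hr.le i) (mul_pos hη (hpos d)) hcmp
    _ = L / η * (r d / (K *ᵥ b) d) := mul_div_mul_comm _ _ _ _

lemma dominated_sinkhornScaling {K : Matrix ι ι ℝ} {η L : ℝ} {d : ι} {r c : ι → ℝ} (hη : 0 < η)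
    (hK : ∀ i j, η ≤ K i j) (hK1 : ∀ i j, K i j ≤ 1) (hr : Dominated d L r)
    (hc : Dominated d L c) (k : ℕ) :
    Dominated d (L / η) (sinkhornScaling K r c k).1 ∧
      Dominated d (L / η) (sinkhornScaling K r c k).2 := by
  have hL : 1 ≤ L := by nlinarith [hr.le d, hr.pos]
  have hη1 : η ≤ 1 := (hK d d).trans (hK1 d d)
  have h1 : Dominated d (L / η) (1 : ι → ℝ) :=
    ⟨fun _ => zero_le_one, zero_lt_one, fun _ => by
      simpa using (one_le_div hη).2 (hη1.trans hL)⟩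
  induction k with
  | zero => exact ⟨h1, h1⟩
  | succ k ih =>
    by_cases hk : Even k
    · rw [sinkhornScaling_succ_of_even _ _ _ hk]
      exact ⟨hr.rescale hη hK hK1 ih.2, ih.2⟩
    · rw [sinkhornScaling_succ_of_not_even _ _ _ hk]
      exact ⟨ih.1, hc.rescale hη (fun i j => hK j i) (fun i j => hK1 j i) ih.1⟩

lemma sum_rescale {K : Matrix ι ι ℝ} {r b : ι → ℝ} {i : ι} (h : (K *ᵥ b) i ≠ 0) :
    ∑ j, rescale K r b i * K i j * b j = r i := by
  simp only [mul_assoc, ← Finset.mul_sum]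
  exact div_mul_cancel₀ _ h

/-- The entry at a dominating index after a half step. -/
lemma le_rescale_mul {K : Matrix ι ι ℝ} {η W : ℝ} {d : ι} {r b : ι → ℝ} (hη : 0 < η)
    (hK : ∀ i j, η ≤ K i j) (hK1 : ∀ i j, K i j ≤ 1) (hr : 0 ≤ r d) (hb : Dominated d W b) :
    r d * η / (Fintype.card ι * W) ≤ rescale K r b d * K d d * b d := by
  have hpos := mulVec_pos (fun i j => hη.trans_le (hK i j)) hb.nonneg hb.pos d
  have hle : (K *ᵥ b) d ≤ Fintype.card ι * W * b d := by
    have : (K *ᵥ b) d ≤ ∑ _j : ι, W * b d := Finset.sum_le_sum fun j _ =>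
      (mul_le_of_le_one_left (hb.nonneg j) (hK1 d j)).trans (hb.le j)
    simpa [mul_assoc] using this
  have hW : 0 < Fintype.card ι * W := pos_of_mul_pos_left (hpos.trans_le hle) hb.pos.le
  calc r d * η / (Fintype.card ι * W) = r d * η * b d / (Fintype.card ι * W * b d) :=
        (mul_div_mul_right _ _ hb.pos.ne').symm
    _ ≤ r d * K d d * b d / (K *ᵥ b) d :=
        div_le_div₀ (mul_nonneg (mul_nonneg hr (hη.trans_le (hK d d)).le) hb.pos.le)
          (mul_le_mul_of_nonneg_right (mul_le_mul_of_nonneg_left (hK d d) hr) hb.pos.le) hpos hle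
    _ = rescale K r b d * K d d * b d := by simp only [rescale]; ring

lemma dominated_of_le {ι : Type*} {d : ι} {S m : ℝ} {v : ι → ℝ} (hv : ∀ i, 0 ≤ v i) (hS : ∀ i, v i ≤ S)
    (hm : 0 < m) (hd : m ≤ v d) : Dominated d (S / m) v := by
  refine ⟨hv, hm.trans_le hd, fun i => (hS i).trans ?_⟩
  rw [div_mul_eq_mul_div, le_div_iff₀ hm]
  exact mul_le_mul_of_nonneg_left hd ((hv i).trans (hS i))

lemma exp_le_gibbs {ι : Type*} {C : Matrix ι ι ℝ} {A γ : ℝ} (hγ : 0 < γ) (hC : ∀ i j, C i j ≤ A) (i j : ι) :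
    Real.exp (-A / γ) ≤ gibbs C γ i j :=
  Real.exp_le_exp.2 (div_le_div_of_nonneg_right (neg_le_neg (hC i j)) hγ.le)

lemma gibbs_le_one {ι : Type*} {C : Matrix ι ι ℝ} {γ : ℝ} (hγ : 0 < γ) (hC : ∀ i j, 0 ≤ C i j) (i j : ι) :
    gibbs C γ i j ≤ 1 :=
  Real.exp_le_one_iff.2 (div_nonpos_of_nonpos_of_nonneg (neg_nonpos.2 (hC i j)) hγ.le)

lemma gibbs_pos {ι : Type*} (C : Matrix ι ι ℝ) (γ : ℝ) (i j : ι) : 0 < gibbs C γ i j := Real.exp_pos _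

lemma sinkhornPlan_zero (C : Matrix ι ι ℝ) (r c : ι → ℝ) (γ : ℝ) :
    sinkhornPlan C r c γ 0 = gibbs C γ := by
  ext i j
  simp [sinkhornPlan, sinkhornScaling]

/-- The cross ratios of a Sinkhorn matrix are those of the kernel. -/
lemma sinkhornPlan_mul_le {C : Matrix ι ι ℝ} {r c : ι → ℝ} {γ : ℝ} {k : ℕ} {d i j : ι}
    (hγ : 0 < γ) (hX : ∀ i j, 0 ≤ sinkhornPlan C r c γ k i j)
    (h : C i d + C d j ≤ C i j) :
    sinkhornPlan C r c γ k d d * sinkhornPlan C r c γ k i j ≤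
      Real.exp (-C d d / γ) * (sinkhornPlan C r c γ k i d * sinkhornPlan C r c γ k d j) := by
  have hK : gibbs C γ i j ≤ gibbs C γ i d * gibbs C γ d j := by
    simp only [gibbs, Matrix.of_apply, ← Real.exp_add, ← add_div]
    exact Real.exp_le_exp.2 (div_le_div_of_nonneg_right (by linarith) hγ.le)
  -- The sign of the product of scalings is read off from the plan, the kernel being positive.
  have h0 : 0 ≤ (sinkhornScaling (gibbs C γ) r c k).1 d *
      (sinkhornScaling (gibbs C γ) r c k).2 d *
      ((sinkhornScaling (gibbs C γ) r c k).1 i * (sinkhornScaling (gibbs C γ) r c k).2 j) := by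
    have h1 := mul_nonneg (hX d d) (hX i j)
    simp only [sinkhornPlan, Matrix.of_apply] at h1
    have h2 := mul_pos (gibbs_pos C γ d d) (gibbs_pos C γ i j)
    refine nonneg_of_mul_nonneg_left (b := gibbs C γ d d * gibbs C γ i j) ?_ h2
    convert h1 using 1
    ring
  have h3 := mul_le_mul_of_nonneg_left hK (mul_nonneg (gibbs_pos C γ d d).le h0)
  have e : Real.exp (-C d d / γ) = gibbs C γ d d := rfl
  rw [e]
  simp only [sinkhornPlan, Matrix.of_apply]
  linarith

/-- Each half step makes one marginal exact, and both marginals have the same total. -/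
lemma sum_sinkhornPlan_succ {C : Matrix ι ι ℝ} {r c : ι → ℝ} {γ A L : ℝ} {d : ι} (hγ : 0 < γ)
    (hC0 : ∀ i j, 0 ≤ C i j) (hCA : ∀ i j, C i j ≤ A) (hr : Dominated d L r)
    (hc : Dominated d L c) (h : ∑ i, r i = ∑ j, c j) (k : ℕ) :
    ∑ i, ∑ j, sinkhornPlan C r c γ (k + 1) i j = ∑ i, r i := by
  obtain ⟨ha, hb⟩ := dominated_sinkhornScaling (Real.exp_pos (-A / γ)) (exp_le_gibbs hγ hCA)
    (gibbs_le_one hγ hC0) hr hc k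
  by_cases hk : Even k
  · refine Finset.sum_congr rfl fun i _ => ?_
    simp only [sinkhornPlan, Matrix.of_apply, sinkhornScaling_succ_of_even _ _ _ hk]
    exact sum_rescale (mulVec_pos (gibbs_pos C γ) hb.nonneg hb.pos i).ne'
  · refine Finset.sum_comm.trans ?_
    rw [h]
    refine Finset.sum_congr rfl fun j _ => ?_
    simp only [sinkhornPlan, Matrix.of_apply, sinkhornScaling_succ_of_not_even _ _ _ hk]
    refine Eq.trans ?_ (sum_rescale (K := (gibbs C γ)ᵀ) (r := c)
      (mulVec_pos (fun i j => gibbs_pos C γ j i) ha.nonneg ha.pos j).ne')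
    refine Finset.sum_congr rfl fun i _ => ?_
    simp only [Matrix.transpose_apply]
    ring

/-- One factor `η` comes from the kernel entry at `d`, the other from the domination constant `L /
η` of the scaling that was not reset. -/
lemma le_sinkhornPlan_succ {C : Matrix ι ι ℝ} {r c : ι → ℝ} {γ A L ρ : ℝ} {d : ι} (hγ : 0 < γ)
    (hC0 : ∀ i j, 0 ≤ C i j) (hCA : ∀ i j, C i j ≤ A) (hr : Dominated d L r)
    (hc : Dominated d L c) (hρr : ρ ≤ r d) (hρc : ρ ≤ c d) (k : ℕ) :
    ρ * Real.exp (-A / γ) / (Fintype.card ι * (L / Real.exp (-A / γ))) ≤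
      sinkhornPlan C r c γ (k + 1) d d := by
  have hη := Real.exp_pos (-A / γ)
  have hK := exp_le_gibbs hγ hCA
  have hK1 := gibbs_le_one hγ hC0
  obtain ⟨ha, hb⟩ := dominated_sinkhornScaling hη hK hK1 hr hc k
  have hL : 0 ≤ L := by nlinarith [hr.le d, hr.pos]
  have hm : 0 ≤ Fintype.card ι * (L / Real.exp (-A / γ)) := by positivity
  by_cases hk : Even k
  · simp only [sinkhornPlan, Matrix.of_apply, sinkhornScaling_succ_of_even _ _ _ hk]
    refine le_trans ?_ (le_rescale_mul hη hK hK1 hr.pos.le hb)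
    gcongr
  · simp only [sinkhornPlan, Matrix.of_apply, sinkhornScaling_succ_of_not_even _ _ _ hk]
    refine le_trans ?_ ((le_rescale_mul (K := (gibbs C γ)ᵀ) hη (fun i j => hK j i)
      (fun i j => hK1 j i) hc.pos.le ha).trans_eq (?_ : _ = _))
    · gcongr
    · simp only [Matrix.transpose_apply]
      ring

lemma sinkhornPlan_nonneg {C : Matrix ι ι ℝ} {r c : ι → ℝ} {γ A L : ℝ} {d : ι} (hγ : 0 < γ)
    (hC0 : ∀ i j, 0 ≤ C i j) (hCA : ∀ i j, C i j ≤ A) (hr : Dominated d L r)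
    (hc : Dominated d L c) (k : ℕ) (i j : ι) : 0 ≤ sinkhornPlan C r c γ k i j := by
  obtain ⟨ha, hb⟩ := dominated_sinkhornScaling (Real.exp_pos (-A / γ)) (exp_le_gibbs hγ hCA)
    (gibbs_le_one hγ hC0) hr hc k
  exact mul_nonneg (mul_nonneg (ha.nonneg i) (gibbs_pos C γ i j).le) (hb.nonneg j)

lemma sinkhornPlan_pos {C : Matrix ι ι ℝ} {r c : ι → ℝ} {γ A L : ℝ} {d : ι} (hγ : 0 < γ)
    (hC0 : ∀ i j, 0 ≤ C i j) (hCA : ∀ i j, C i j ≤ A) (hr : Dominated d L r)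
    (hc : Dominated d L c) (k : ℕ) : 0 < sinkhornPlan C r c γ k d d := by
  obtain ⟨ha, hb⟩ := dominated_sinkhornScaling (Real.exp_pos (-A / γ)) (exp_le_gibbs hγ hCA)
    (gibbs_le_one hγ hC0) hr hc k
  exact mul_pos (mul_pos ha.pos (gibbs_pos C γ d d)) hb.pos

end Scaling

/-! ### The extended problem and its dummy pair -/

section Extended

variable {n : ℕ}

lemma sum_extMarginal (r c : Fin n → ℝ) (s : ℝ) :
    ∑ i, extMarginal r c s i = (∑ i, r i) + ∑ j, c j - s := by
  simp [extMarginal, Fintype.sum_sum_type, add_sub_assoc]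

lemma extMarginal_le {r c : Fin n → ℝ} {s S : ℝ} (hr : ∀ i, 0 ≤ r i) (hs : 0 ≤ s)
    (hrS : ∑ i, r i ≤ S) (hcS : ∑ j, c j ≤ S) (i : Fin n ⊕ Unit) : extMarginal r c s i ≤ S := by
  rcases i with i | i
  · exact (Finset.single_le_sum (fun i _ => hr i) (Finset.mem_univ i)).trans hrS
  · exact (sub_le_self _ hs).trans hcS

lemma extMarginal_nonneg {r c : Fin n → ℝ} {s : ℝ} (hr : ∀ i, 0 ≤ r i) (hs : s ≤ ∑ j, c j)
    (i : Fin n ⊕ Unit) : 0 ≤ extMarginal r c s i := by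
  rcases i with i | i
  · exact hr i
  · exact sub_nonneg.2 hs

lemma extCost_nonneg {C : Matrix (Fin n) (Fin n) ℝ} {A : ℝ} (hC : ∀ i j, 0 ≤ C i j)
    (hA : 0 ≤ A) (i j : Fin n ⊕ Unit) : 0 ≤ extCost C A i j := by
  rcases i with i | i <;> rcases j with j | j <;> simp [extCost, hC, hA]

lemma extCost_le {C : Matrix (Fin n) (Fin n) ℝ} {A : ℝ} (hC : ∀ i j, C i j ≤ A)
    (hA : 0 ≤ A) (i j : Fin n ⊕ Unit) : extCost C A i j ≤ A := by
  rcases i with i | i <;> rcases j with j | j <;> simp [extCost, hC, hA]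

lemma le_maxNorm {ι : Type*} [Fintype ι] (C : Matrix ι ι ℝ) (i j : ι) : |C i j| ≤ maxNorm C :=
  le_ciSup (f := fun p : ι × ι => |C p.1 p.2|) (Set.finite_range _).bddAbove (i, j)

/-- The violation of a coupling of the extended marginals is the mass between the dummy points. -/
lemma violation_toBlocks₁₁ {Y : Matrix (Fin n ⊕ Unit) (Fin n ⊕ Unit) ℝ} {r c : Fin n → ℝ} {s : ℝ}
    (hr : ∀ i, ∑ j, Y i j = extMarginal r c s i) (hc : ∀ j, ∑ i, Y i j = extMarginal c r s j) :
    violation Y.toBlocks₁₁ s = Y (Sum.inr ()) (Sum.inr ()) := by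
  have h1 := hr (Sum.inr ())
  have h2 : ∑ i, ((∑ j, Y (Sum.inl i) (Sum.inl j)) + Y (Sum.inl i) (Sum.inr ())) = ∑ i, r i :=
    Finset.sum_congr rfl fun i _ => by simpa [extMarginal, Fintype.sum_sum_type] using hr (Sum.inl i)
  have h3 := hc (Sum.inr ())
  rw [Finset.sum_add_distrib] at h2
  simp only [Fintype.sum_sum_type, extMarginal, Sum.elim_inr, Finset.univ_unique,
    PUnit.default_eq_unit, Finset.sum_singleton] at h1 h3
  simp only [violation, Matrix.toBlocks₁₁, Matrix.of_apply]
  linarith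

lemma sum_le_add_marginalError {ι : Type*} [Fintype ι] (X : Matrix ι ι ℝ) (r c : ι → ℝ) :
    ∑ i, ∑ j, X i j ≤ (∑ i, r i) + marginalError X r c := by
  have h1 : ∑ i, ((∑ j, X i j) - r i) ≤ ∑ i, |(∑ j, X i j) - r i| :=
    Finset.sum_le_sum fun i _ => le_abs_self _
  have h2 : 0 ≤ ∑ j, |(∑ i, X i j) - c j| := Finset.sum_nonneg fun _ _ => abs_nonneg _
  rw [Finset.sum_sub_distrib] at h1
  simp only [marginalError]
  linarith

/-- Up to the marginal error, the genuine points carry at least the mass of the dummy pair. -/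
lemma dummy_le_sum_add {X : Matrix (Fin n ⊕ Unit) (Fin n ⊕ Unit) ℝ} {r c : Fin n → ℝ} {s : ℝ}
    (hs : 0 ≤ s) :
    X (Sum.inr ()) (Sum.inr ()) ≤ (∑ i, ∑ j, X (Sum.inl i) (Sum.inl j)) +
      2 * marginalError X (extMarginal r c s) (extMarginal c r s) := by
  -- Total mass minus dummy row minus dummy column is the genuine mass minus the dummy pair. For
  -- exact marginals this equals `s ≥ 0`.
  have h1 : -(∑ i, ((∑ j, X i j) - extMarginal r c s i)) ≤
      ∑ i, |(∑ j, X i j) - extMarginal r c s i| := by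
    rw [← Finset.sum_neg_distrib]
    exact Finset.sum_le_sum fun i _ => neg_le_abs _
  have h2 := Finset.single_le_sum (f := fun i => |(∑ j, X i j) - extMarginal r c s i|)
    (fun i _ => abs_nonneg _) (Finset.mem_univ (Sum.inr ()))
  have h3 := Finset.single_le_sum (f := fun j => |(∑ i, X i j) - extMarginal c r s j|)
    (fun i _ => abs_nonneg _) (Finset.mem_univ (Sum.inr ()))
  have h4 := le_abs_self ((∑ j, X (Sum.inr ()) j) - extMarginal r c s (Sum.inr ()))
  have h5 := le_abs_self ((∑ i, X i (Sum.inr ())) - extMarginal c r s (Sum.inr ()))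
  have h6 : 0 ≤ ∑ j, |(∑ i, X i j) - extMarginal c r s j| :=
    Finset.sum_nonneg fun _ _ => abs_nonneg _
  rw [Finset.sum_sub_distrib, sum_extMarginal] at h1
  unfold marginalError
  generalize ∑ i, |(∑ j, X i j) - extMarginal r c s i| = E1 at *
  generalize ∑ j, |(∑ i, X i j) - extMarginal c r s j| = E2 at *
  simp only [Fintype.sum_sum_type, extMarginal, Sum.elim_inr, Finset.univ_unique,
    PUnit.default_eq_unit, Finset.sum_singleton, Finset.sum_add_distrib] at h1 h2 h3 h4 h5
  linarith

/-- The mass that a Sinkhorn matrix of the extended problem puts on the dummy pair. -/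
lemma sinkhornPlan_dummy_le {C : Matrix (Fin n) (Fin n) ℝ} {r c : Fin n → ℝ}
    {s A γ T δ : ℝ} {k : ℕ} {X : Matrix (Fin n ⊕ Unit) (Fin n ⊕ Unit) ℝ} (hγ : 0 < γ)
    (hC : ∀ i j, 0 ≤ C i j) (hs : 0 ≤ s) (hX : ∀ i j, 0 ≤ X i j)
    (hXk : X = sinkhornPlan (extCost C A) (extMarginal r c s) (extMarginal c r s) γ k)
    (hδ : marginalError X (extMarginal r c s) (extMarginal c r s) ≤ δ)
    (hT : ∑ i, ∑ j, X i j ≤ T) :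
    X (Sum.inr ()) (Sum.inr ()) ≤ 4 * δ + 2 * T * Real.exp (-A / (2 * γ)) := by
  have hX0 := hX (Sum.inr ()) (Sum.inr ())
  have hrow : ∀ i, 0 ≤ ∑ j, X i j := fun i => Finset.sum_nonneg fun j _ => hX i j
  have hT0 : 0 ≤ T := (Finset.sum_nonneg fun i _ => hrow i).trans hT
  have hδ0 : 0 ≤ δ := le_trans (add_nonneg (Finset.sum_nonneg fun _ _ => abs_nonneg _)
    (Finset.sum_nonneg fun _ _ => abs_nonneg _)) hδ
  have hE := Real.exp_pos (-A / (2 * γ))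
  -- Above this threshold the error `2 * δ` costs at most half of the dummy entry, so the genuine
  -- mass is at least the other half.
  by_cases hsmall : X (Sum.inr ()) (Sum.inr ()) ≤ 4 * δ
  · exact hsmall.trans (le_add_of_nonneg_right (by positivity))
  have hS := dummy_le_sum_add (X := X) (r := r) (c := c) hs
  have hQ : ∑ j, X (Sum.inr ()) (Sum.inl j) ≤ T := by
    refine le_trans ?_ ((Finset.single_le_sum (fun i _ => hrow i)
      (Finset.mem_univ (Sum.inr ()))).trans hT)
    rw [Fintype.sum_sum_type]
    exact le_add_of_nonneg_right (Finset.sum_nonneg fun j _ => hX _ _)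
  have hP : ∑ i, X (Sum.inl i) (Sum.inr ()) ≤ T := by
    refine le_trans ?_ hT
    rw [Fintype.sum_sum_type]
    refine le_trans (Finset.sum_le_sum fun i _ => ?_)
      (le_add_of_nonneg_right (Finset.sum_nonneg fun j _ => hrow _))
    exact Finset.single_le_sum (fun j _ => hX (Sum.inl i) j) (Finset.mem_univ (Sum.inr ()))
  have hprod : X (Sum.inr ()) (Sum.inr ()) * ∑ i, ∑ j, X (Sum.inl i) (Sum.inl j) ≤
      Real.exp (-A / γ) *
        ((∑ i, X (Sum.inl i) (Sum.inr ())) * ∑ j, X (Sum.inr ()) (Sum.inl j)) := by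
    rw [Finset.sum_mul_sum]
    simp only [Finset.mul_sum]
    refine Finset.sum_le_sum fun i _ => Finset.sum_le_sum fun j _ => ?_
    subst hXk
    exact sinkhornPlan_mul_le hγ hX (by simp [extCost, hC])
  have hPQ : (∑ i, X (Sum.inl i) (Sum.inr ())) * ∑ j, X (Sum.inr ()) (Sum.inl j) ≤ T * T :=
    mul_le_mul hP hQ (Finset.sum_nonneg fun _ _ => hX _ _) hT0
  have hEE : Real.exp (-A / γ) = Real.exp (-A / (2 * γ)) * Real.exp (-A / (2 * γ)) := by
    rw [← Real.exp_add]
    congr 1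
    field_simp
    ring
  rw [hEE] at hprod
  have h1 := hprod.trans (mul_le_mul_of_nonneg_left hPQ (mul_pos hE hE).le)
  have h2 : X (Sum.inr ()) (Sum.inr ()) / 2 ≤ ∑ i, ∑ j, X (Sum.inl i) (Sum.inl j) := by linarith
  have h3 := mul_le_mul_of_nonneg_left h2 hX0
  have h4 : X (Sum.inr ()) (Sum.inr ()) ^ 2 ≤ (2 * T * Real.exp (-A / (2 * γ))) ^ 2 := by
    nlinarith [mul_nonneg (mul_pos hE hE).le (mul_nonneg hT0 hT0)]
  have h5 := abs_le_of_sq_le_sq' h4 (by positivity)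
  linarith [h5.2]

end Extended

/-! ### Quantitative bounds and the theorem -/

/-- The violation is the mass that the rounded plan puts on the dummy pair. -/
lemma violation_eq_roundOT {n : ℕ} {X : Matrix (Fin n ⊕ Unit) (Fin n ⊕ Unit) ℝ} {r c : Fin n → ℝ}
    {s : ℝ} (hX : ∀ i j, 0 ≤ X i j) (hr : ∀ i, 0 ≤ r i) (hc : ∀ j, 0 ≤ c j) (hsr : s ≤ ∑ i, r i)
    (hsc : s ≤ ∑ j, c j) :
    violation (roundOT X (extMarginal r c s) (extMarginal c r s)).toBlocks₁₁ s =
      roundOT X (extMarginal r c s) (extMarginal c r s) (Sum.inr ()) (Sum.inr ()) := by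
  have h : ∑ i, extMarginal r c s i = ∑ j, extMarginal c r s j := by
    rw [sum_extMarginal, sum_extMarginal, add_comm (∑ i, r i)]
  exact violation_toBlocks₁₁ (sum_row_roundOT hX (extMarginal_nonneg hr hsc) h)
    (sum_col_roundOT hX (extMarginal_nonneg hr hsc) (extMarginal_nonneg hc hsr) h)

/-- The dummy pair of the rounded plan carries at most `O(ε / A)` mass. -/
lemma roundOT_dummy_le {n k : ℕ} {C : Matrix (Fin n) (Fin n) ℝ} {r c : Fin n → ℝ} {s A ε : ℝ}
    {X : Matrix (Fin n ⊕ Unit) (Fin n ⊕ Unit) ℝ} (hn : 2 ≤ n) (hC : ∀ i j, 0 ≤ C i j)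
    (hr : ∀ i, 0 ≤ r i) (hc : ∀ j, 0 ≤ c j) (hs : 0 ≤ s) (hsr : s ≤ ∑ i, r i)
    (hsc : s ≤ ∑ j, c j) (hA : 0 < A) (hε : 0 < ε) (hX : ∀ i j, 0 ≤ X i j)
    (hXk : X = sinkhornPlan (extCost C A) (extMarginal r c s) (extMarginal c r s)
      (ε / (4 * Real.log n)) k)
    (hδ : marginalError X (extMarginal r c s) (extMarginal c r s) ≤ ε / (8 * A)) :
    roundOT X (extMarginal r c s) (extMarginal c r s) (Sum.inr ()) (Sum.inr ()) ≤
      2 * (1 + (∑ i, r i) + ∑ j, c j) * (ε / A) := by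
  have hl : 1 / 2 ≤ Real.log n := by
    have := Real.log_le_log (by norm_num) (Nat.ofNat_le_cast.2 hn : (2 : ℝ) ≤ n)
    linarith [Real.log_two_gt_d9]
  have hγ : 0 < ε / (4 * Real.log n) := by positivity
  have h : ∑ i, extMarginal r c s i = ∑ j, extMarginal c r s j := by
    rw [sum_extMarginal, sum_extMarginal, add_comm (∑ i, r i)]
  have hT := sum_le_add_marginalError X (extMarginal r c s) (extMarginal c r s)
  rw [sum_extMarginal] at hT
  have h1 := roundOT_le hX (extMarginal_nonneg hr hsc) (extMarginal_nonneg hc hsr) h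
    (Sum.inr ()) (Sum.inr ())
  -- Bounding the mass by the stopping test also covers the initial iterate, which matches neither
  -- marginal.
  have h2 := sinkhornPlan_dummy_le (T := (∑ i, r i) + (∑ j, c j) + ε / (8 * A)) hγ hC hs hX hXk hδ
    (by linarith)
  have hx : A / ε ≤ A / (2 * (ε / (4 * Real.log n))) := by
    have : A / (2 * (ε / (4 * Real.log n))) = A / ε * (2 * Real.log n) := by
      field_simp
      ring
    rw [this]
    exact le_mul_of_one_le_right (by positivity) (by linarith)
  have hE1 : Real.exp (-A / (2 * (ε / (4 * Real.log n)))) ≤ 1 :=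
    Real.exp_le_one_iff.2 (by rw [neg_div]; exact neg_nonpos.2 (by positivity))
  -- Uses `exp (-x) ≤ 1 / x` with `x = A / (2γ) ≥ A / ε`.
  have hE2 : Real.exp (-A / (2 * (ε / (4 * Real.log n)))) ≤ ε / A := by
    rw [neg_div, Real.exp_neg, ← inv_div A ε]
    refine inv_anti₀ (by positivity) (hx.trans ?_)
    linarith [Real.add_one_le_exp (A / (2 * (ε / (4 * Real.log n))))]
  have hM : 0 ≤ (∑ i, r i) + ∑ j, c j := by linarith
  have hδ0 : 0 ≤ ε / (8 * A) := by positivity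
  have h3 := mul_le_mul_of_nonneg_left hE2 hM
  have h4 := mul_le_mul_of_nonneg_left hE1 hδ0
  have h5 : ε / A = 8 * (ε / (8 * A)) := by field_simp
  nlinarith

/-- The part of the dummy pair that is left by the rounding, for masses that are polynomial
in `n`. -/
lemma le_roundOT_dummy {n k : ℕ} {C : Matrix (Fin n) (Fin n) ℝ} {r c : Fin n → ℝ} {s A ε κ : ℝ}
    (hn : 2 ≤ n) (hC : ∀ i j, 0 ≤ C i j) (hCA : ∀ i j, C i j ≤ A)
    (hr : ∀ i, 0 ≤ r i) (hc : ∀ j, 0 ≤ c j) (hs : 0 ≤ s) (hA : 0 < A) (hε : 0 < ε) (hκ : 0 ≤ κ)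
    (hrκ : ∑ i, r i ≤ (n : ℝ) ^ κ) (hcκ : ∑ j, c j ≤ (n : ℝ) ^ κ)
    (hsr : (n : ℝ) ^ (-κ) ≤ (∑ i, r i) - s) (hsc : (n : ℝ) ^ (-κ) ≤ (∑ j, c j) - s) :
    Real.exp (-(12 * A * Real.log n / ε) - 10 * (1 + κ) * Real.log n) ≤
      roundOT (sinkhornPlan (extCost C A) (extMarginal r c s) (extMarginal c r s)
        (ε / (4 * Real.log n)) k) (extMarginal r c s) (extMarginal c r s)
        (Sum.inr ()) (Sum.inr ()) := by
  have hn2 : (2 : ℝ) ≤ n := Nat.ofNat_le_cast.2 hn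
  have hn0 : (0 : ℝ) < n := by linarith
  have hl : 0 < Real.log n := Real.log_pos (by linarith)
  have hγ : 0 < ε / (4 * Real.log n) := by positivity
  rw [Real.rpow_def_of_pos hn0] at hrκ hcκ hsr hsc
  have hexp : Real.exp (Real.log n) = n := Real.exp_log hn0
  have hρ := Real.exp_pos (Real.log n * -κ)
  have hr0 := extMarginal_nonneg (r := r) (c := c) (s := s) hr (by linarith)
  have hc0 := extMarginal_nonneg (r := c) (c := r) (s := s) hc (by linarith)
  have hrD := dominated_of_le hr0 (extMarginal_le hr hs hrκ hcκ) hρ (d := Sum.inr ()) hsc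
  have hcD := dominated_of_le hc0 (extMarginal_le hc hs hcκ hrκ) hρ (d := Sum.inr ()) hsr
  have hC0 := extCost_nonneg hC hA.le
  have hCA' := extCost_le hCA hA.le
  have hsum : ∑ i, extMarginal r c s i = ∑ j, extMarginal c r s j := by
    rw [sum_extMarginal, sum_extMarginal, add_comm (∑ i, r i)]
  have hκ1 : 1 ≤ Real.exp (Real.log n * κ) := Real.one_le_exp (by positivity)
  have hTeq : Real.exp (Real.log n * (κ + 4)) = Real.exp (Real.log n * κ) * n ^ 4 := by
    rw [mul_add, Real.exp_add, mul_comm (Real.log n) 4, ← hexp, ← Real.exp_nat_mul, hexp]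
    norm_num
  have hcard : (Fintype.card (Fin n ⊕ Unit) : ℝ) = n + 1 := by simp
  have hη : -A / (ε / (4 * Real.log n)) = -(4 * A * Real.log n / ε) := by
    field_simp
  have hx : 0 < A * Real.log n / ε := by positivity
  have hn12 : (n : ℝ) + 1 ≤ n ^ 2 := by nlinarith
  have hn4 : (n : ℝ) ^ 2 ≤ n ^ 4 := pow_le_pow_right₀ (by linarith) (by norm_num)
  -- The exponent `κ + 4` serves both the initial kernel, of mass at most `(n + 1)² ≤ n⁴`, and later
  -- iterates, of mass at most `2 n^κ`.
  have hXT : ∑ i, ∑ j, sinkhornPlan (extCost C A) (extMarginal r c s) (extMarginal c r s)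
        (ε / (4 * Real.log n)) k i j ≤ Real.exp (Real.log n * (κ + 4)) := by
    rw [hTeq]
    cases k with
    | zero =>
      rw [sinkhornPlan_zero]
      calc _ ≤ ∑ _i : Fin n ⊕ Unit, ∑ _j : Fin n ⊕ Unit, (1 : ℝ) :=
            Finset.sum_le_sum fun i _ => Finset.sum_le_sum fun j _ => gibbs_le_one hγ hC0 i j
        _ = ((n : ℝ) + 1) * (n + 1) := by simp [mul_add_one]
        _ ≤ n ^ 2 * n ^ 2 := by gcongr
        _ ≤ Real.exp (Real.log n * κ) * n ^ 4 := by
            rw [← pow_add]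
            exact le_mul_of_one_le_left (by positivity) hκ1
    | succ k =>
      rw [sum_sinkhornPlan_succ hγ hC0 hCA' hrD hcD hsum, sum_extMarginal]
      have := mul_le_mul_of_nonneg_left (show (2 : ℝ) ≤ n ^ 4 by linarith)
        (Real.exp_pos (Real.log n * κ)).le
      linarith
  have hdd : Real.exp (-(8 * A * Real.log n / ε) - (3 * κ + 2) * Real.log n) ≤
      sinkhornPlan (extCost C A) (extMarginal r c s) (extMarginal c r s)
        (ε / (4 * Real.log n)) k (Sum.inr ()) (Sum.inr ()) := by
    cases k with
    | zero =>
      rw [sinkhornPlan_zero]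
      refine le_trans (Real.exp_le_exp.2 ?_) (exp_le_gibbs hγ hCA' _ _)
      rw [hη]
      have : 0 ≤ (3 * κ + 2) * Real.log n := by positivity
      have e : 8 * A * Real.log n / ε = 4 * A * Real.log n / ε + 4 * (A * Real.log n / ε) := by ring
      linarith
    | succ k =>
      refine le_trans ?_ (le_sinkhornPlan_succ hγ hC0 hCA' hrD hcD hsc hsr k)
      rw [hη, hcard, ← Real.exp_sub, ← Real.exp_sub, ← Real.exp_add, le_div_iff₀ (by positivity)]
      refine (mul_le_mul_of_nonneg_left (mul_le_mul_of_nonneg_right hn12 (Real.exp_pos _).le)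
        (Real.exp_pos _).le).trans_eq ?_
      nth_rewrite 3 [← hexp]
      rw [← Real.exp_nat_mul, ← Real.exp_add, ← Real.exp_add]
      congr 1
      push_cast
      ring
  refine le_trans ?_ (mul_le_roundOT (sinkhornPlan_nonneg hγ hC0 hCA' hrD hcD k) hr0 hc0 hρ.le
    (Real.exp_le_exp.2 (mul_le_mul_of_nonneg_left (by linarith) hl.le)) hXT hsc hsr)
  refine le_trans ?_ (mul_le_mul_of_nonneg_left hdd (sq_nonneg _))
  -- Rounding costs `n^(-4κ-8)` and `hdd` costs `n^(-3κ-2)`, together at most `n^(-10(1+κ))`. The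
  -- kernel needs only 8 of the allowed 12.
  rw [← Real.exp_sub, ← Real.exp_nat_mul, ← Real.exp_add]
  refine Real.exp_le_exp.2 ?_
  push_cast
  have e : 12 * A * Real.log n / ε = 8 * A * Real.log n / ε + 4 * (A * Real.log n / ε) := by ring
  nlinarith [mul_nonneg hκ hl.le]

end POT

theorem mainTheorem4 :
    ∃ K₁ > (0 : ℝ), ∃ K₂ > (0 : ℝ),
      ∀ (n : ℕ) (C : Matrix (Fin n) (Fin n) ℝ) (r c : Fin n → ℝ) (s A ε : ℝ)
        (Xbar : Matrix (Fin n) (Fin n) ℝ),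
        2 ≤ n → (∀ i j, 0 ≤ C i j) → (∀ i, 0 ≤ r i) → (∀ j, 0 ≤ c j) →
        0 ≤ s → s < ∑ i, r i → s < ∑ j, c j →
        (∀ i j, C i j < A) → 0 < ε →
        POT.IsSinkhornPOT C r c s A ε Xbar →
        0 < POT.violation Xbar s ∧
        POT.violation Xbar s
          ≤ K₁ * (1 + (∑ i, r i) + ∑ j, c j) * (max (POT.maxNorm C) ε / A) ∧
        ∀ κ : ℝ, 0 ≤ κ →
          (∑ i, r i) ≤ (n : ℝ) ^ κ → (∑ j, c j) ≤ (n : ℝ) ^ κ →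
          (n : ℝ) ^ (-κ) ≤ (∑ i, r i) - s → (n : ℝ) ^ (-κ) ≤ (∑ j, c j) - s →
          Real.exp (-(12 * A * Real.log n / ε) - K₂ * (1 + κ) * Real.log n)
            ≤ POT.violation Xbar s := by
  open POT in
  refine ⟨2, two_pos, 10, by norm_num, ?_⟩
  rintro n C r c s A ε Xbar hn hC hr hc hs hsr hsc hCA hε ⟨X, ⟨k, hXk, hδ⟩, rfl⟩
  have hA : 0 < A := (hC ⟨0, by omega⟩ ⟨0, by omega⟩).trans_lt (hCA _ _)
  have hγ : 0 < ε / (4 * Real.log n) := by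
    have : 0 < Real.log n := Real.log_pos (by exact_mod_cast hn)
    positivity
  have hC0 := extCost_nonneg hC hA.le
  have hCA' := extCost_le (fun i j => (hCA i j).le) hA.le
  have hr0 := extMarginal_nonneg hr hsc.le
  have hc0 := extMarginal_nonneg hc hsr.le
  have hm : 0 < min ((∑ i, r i) - s) ((∑ j, c j) - s) :=
    lt_min (sub_pos.2 hsr) (sub_pos.2 hsc)
  have hrD := dominated_of_le hr0 (extMarginal_le hr hs (le_max_left _ _) (le_max_right _ _)) hm
    (d := Sum.inr ()) (min_le_right _ _)
  have hcD := dominated_of_le hc0 (extMarginal_le hc hs (le_max_right _ _) (le_max_left _ _)) hm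
    (d := Sum.inr ()) (min_le_left _ _)
  have hX : ∀ i j, 0 ≤ X i j := fun i j => hXk ▸ sinkhornPlan_nonneg hγ hC0 hCA' hrD hcD k i j
  have hXd : 0 < X (Sum.inr ()) (Sum.inr ()) :=
    hXk ▸ sinkhornPlan_pos hγ hC0 hCA' hrD hcD k
  rw [violation_eq_roundOT hX hr hc hsr.le hsc.le]
  refine ⟨?_, ?_, fun κ hκ hrκ hcκ hsrκ hscκ => ?_⟩
  -- Positivity needs no quantitative `T`: the maximum of `ρ` and the total mass suffices.
  · refine lt_of_lt_of_le ?_ (mul_le_roundOT hX hr0 hc0 hm.le (le_max_left _ (∑ i, ∑ j, X i j))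
      (le_max_right _ _) (min_le_right _ _) (min_le_left _ _))
    exact mul_pos (pow_pos (div_pos hm (lt_max_of_lt_left hm)) 2) hXd
  · have hAmax : A ≤ maxNorm (extCost C A) := by
      simpa [extCost, abs_of_pos hA] using le_maxNorm (extCost C A) (Sum.inr ()) (Sum.inr ())
    refine (roundOT_dummy_le hn hC hr hc hs hsr.le hsc.le hA hε hX hXk
      (hδ.trans (by gcongr))).trans ?_
    -- The bound obtained has `ε / A` alone; the maximum with `maxNorm C` only weakens it.
    refine mul_le_mul_of_nonneg_left (div_le_div_of_nonneg_right (le_max_right _ _) hA.le) ?_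
    linarith
  · rw [hXk]
    exact le_roundOT_dummy hn hC (fun i j => (hCA i j).le) hr hc hs hA hε hκ hrκ hcκ hsrκ hscκ
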